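/- Let $P\subset\mathbb{R}^2$ be a lattice polygon, that is, a two-dimensional convex polytope all of whose vertices lie in $\mathbb{Z}^2$. For $S\subset\mathbb{R}^2$ bounded let $L^1(S)=\sum_{x\in S\cap\mathbb{Z}^2}x\in\mathbb{R}^2$. The $h^1$-tensor polynomial of $P$ is the polynomial $h^1_P(t)=\sum_{i=0}^{3}h_i t^i$ with coefficients $h_i\in\mathbb{R}^2$ determined by $$L^1(nP)=\sum_{i=0}^{3}h_i\binom{n+3-i}{3}\qquad\text{for all integers } n\ge 0.$$ Let $\mathcal{T}$ be any unimodular triangulation of $P$, that is, a triangulation of $P$ into triangles of area $1/2$ with vertices in $\mathbb{Z}^2$. Put $V=P\cap\mathbb{Z}^2$ and $V^\circ=P^\circ\cap\mathbb{Z}^2$, where $P^\circ$ is the interior of $P$, and let $E^\circ$ be the set of edges $\{y,z\}$ of $\mathcal{T}$ whose open segment $(y,z)$ is not contained in the boundary $\partial P$. Then $h^1_P$ exists, is unique, and $$h^1_P(t)=t\sum_{x\in V}x+t^2\Bigl(\sum_{\{y,z\}\in E^\circ}(y+z)-2\sum_{x\in V^\circ}x\Bigr)+t^3\sum_{x\in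 V^\circ}x.$$ -/

import Mathlib

open scoped Pointwise

noncomputable section

namespace EhrhartTensor

/-- The lattice points `S ∩ ℤ^d` of a set `S ⊆ ℝ^d`. -/
def latticePoints {d : ℕ} (S : Set (Fin d → ℝ)) : Set (Fin d → ℝ) :=
  {x | x ∈ S ∧ ∀ i, ∃ k : ℤ, x i = k}

/-- `P ⊆ ℝ²` is a lattice polygon: the convex hull of finitely many points of `ℤ²`, and of
dimension two. -/
def IsLatticePolygon (P : Set (Fin 2 → ℝ)) : Prop :=
  (∃ s : Finset (Fin 2 → ℝ), (∀ v ∈ s, ∀ i, ∃ k : ℤ, v i = k) ∧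
    P = convexHull ℝ (s : Set (Fin 2 → ℝ))) ∧
  affineSpan ℝ P = ⊤

/-- The discrete moment vector `L¹(S)`, the sum of all lattice points in `S` (a finite sum
whenever `S` is bounded). -/
def discreteMomentVector {d : ℕ} (S : Set (Fin d → ℝ)) : Fin d → ℝ :=
  ∑ᶠ x ∈ latticePoints S, x

/-- `h` is the `h¹`-tensor polynomial `∑_{i=0}^{d+1} h_i t^i` of the `d`-dimensional lattice
polytope `P ⊆ ℝ^d`. It is a polynomial of degree at most `d + 1` with coefficients
`h.coeff i` in `ℝ^d`, and `L¹(nP) = ∑_{i=0}^{d+1} h_i binom(n + d + 1 - i, d + 1)` for every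
natural number `n`. -/
def IsHOneTensorPolynomial {d : ℕ} (P : Set (Fin d → ℝ))
    (h : PolynomialModule ℝ (Fin d → ℝ)) : Prop :=
  (∀ i, d + 1 < i → h.coeff i = 0) ∧
  ∀ n : ℕ, discreteMomentVector ((n : ℝ) • P) =
    ∑ i ∈ Finset.range (d + 2), (((n + d + 1 - i).choose (d + 1) : ℕ) : ℝ) • h.coeff i

/-- The simplicial complex `K` in `ℝ²` is a unimodular triangulation of `P`: it is finite, it
covers exactly `P`, its vertices are lattice points and each of its maximal simplices has the
minimal possible area `1/2`. -/
structure IsUnimodularTriangulation (K : Geometry.SimplicialComplex ℝ (Fin 2 → ℝ))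
    (P : Set (Fin 2 → ℝ)) : Prop where
  finite_faces : K.faces.Finite
  space_eq : K.space = P
  vertices_lattice : ∀ s ∈ K.faces, ∀ v ∈ s, ∀ i, ∃ k : ℤ, v i = k
  area_eq : ∀ s ∈ K.facets,
    MeasureTheory.volume (convexHull ℝ (s : Set (Fin 2 → ℝ))) = 1 / 2

/-- The set `E°` of the edges `{y, z}` of the triangulation `K` of `P` whose open segment
`(y, z)` is not contained in the boundary of `P`. -/
def interiorEdges (K : Geometry.SimplicialComplex ℝ (Fin 2 → ℝ)) (P : Set (Fin 2 → ℝ)) :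
    Set (Finset (Fin 2 → ℝ)) :=
  {e | e ∈ K.faces ∧ ∃ y z, y ≠ z ∧ e = {y, z} ∧ ¬ openSegment ℝ y z ⊆ frontier P}

end EhrhartTensor

end

namespace EhrhartTensor

/-! The triangulation splits `P` into the relative interiors of its faces. By unimodularity a
lattice point of `nP`, for `n ≥ 1`, is exactly a face `s` with positive integer weights on its
vertices of sum `n`: the barycentric coordinates are quotients by a determinant `±1`
(`exists_int_weight`, `latticePoints_smul`, `injOn_weights`). Over all such weights a vertex of `s`
receives `n.choose s.card` in total (`sum_positiveWeights`). So `L¹(nP)` is the sum of `n.choose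
s.card • v` over all pairs `v ∈ s`, and the coefficient of a vertex `v` is `n + C(n,2) · deg v +
C(n,3) · tri v`, where `deg v` and `tri v` count the edges and triangles at `v`.

What remains is local. Let `e v` be the number of interior edges at `v`, and `β = 0` or `1` as `v`
is interior to `P` or not. Then `deg v = e v + 2β` and `tri v = e v + β`. To see this without
studying links, orient each edge away from `v`: it has at most one triangle on its left, and has one
unless `P` lies weakly to its right. For either sign, exactly `β` edges at `v` have `P` on the
prescribed side (`card_filter_onSide`). Pascal's rule turns the coefficient of `v` into the claimed
combination of `C(n+2,3)`, `C(n+1,3)` and `C(n,3)`. The vertices are precisely the lattice points of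
`P`. The values at `n = 0, 1, 2, 3` determine the coefficients through a unitriangular system. -/

open Finset

/-! ### Positive integer weights with a given sum -/

/-- The positive integer weights on `s` of total weight `n`. -/
def positiveWeights {ι : Type*} [DecidableEq ι] (s : Finset ι) (n : ℕ) : Finset (ι → ℕ) :=
  {w ∈ Finset.piAntidiag s n | ∀ u ∈ s, w u ≠ 0}

/-- `piAntidiag` forces weights to vanish off `s`, so the support is exactly `s` and a weight is
determined by its values there. -/
lemma mem_positiveWeights {ι : Type*} [DecidableEq ι] {s : Finset ι} {n : ℕ} {w : ι → ℕ} :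
    w ∈ positiveWeights s n ↔ ∑ v ∈ s, w v = n ∧ ∀ v, w v ≠ 0 ↔ v ∈ s := by
  simp only [positiveWeights, mem_filter, mem_piAntidiag]
  grind

/-- Splitting off the value at a new point `a` from a positive weight. -/
lemma sum_positiveWeights_insert {ι : Type*} [DecidableEq ι] {s : Finset ι} {a : ι} (ha : a ∉ s)
    (n : ℕ) {v : ι} (hv : v ≠ a) :
    ∑ w ∈ positiveWeights (insert a s) n, w v =
      ∑ j ∈ Finset.range n, ∑ w ∈ positiveWeights s j, w v := by
  rw [Finset.sum_sigma']
  -- The index `j` is the weight left for `s`, so `w a = n - j`; positivity of `w a` is why `j < n`.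
  refine Finset.sum_bij' (fun w _ => ⟨n - w a, Function.update w a 0⟩)
    (fun x _ => Function.update x.2 a (n - x.1)) ?_ ?_ ?_ ?_ ?_
  · intro w hw
    rw [mem_positiveWeights, Finset.sum_insert ha] at hw
    have hs : ∑ u ∈ s, Function.update w a 0 u = ∑ u ∈ s, w u :=
      Finset.sum_congr rfl fun u hu => by
        rw [Function.update_of_ne (by rintro rfl; exact ha hu)]
    have h1 := (hw.2 a).2 (by simp)
    simp only [mem_sigma, mem_range, mem_positiveWeights]
    refine ⟨by omega, by omega, fun u => ?_⟩
    have := hw.2 u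
    by_cases hu : u = a
    · subst hu; simpa using ha
    · simpa [hu] using this
  · rintro ⟨j, w⟩ hw
    simp only [mem_sigma, mem_range, mem_positiveWeights] at hw
    rw [mem_positiveWeights, Finset.sum_insert ha]
    have hs : ∑ u ∈ s, Function.update w a (n - j) u = ∑ u ∈ s, w u :=
      Finset.sum_congr rfl fun u hu => by
        rw [Function.update_of_ne (by rintro rfl; exact ha hu)]
    refine ⟨by simp only [hs, Function.update_self]; omega, fun u => ?_⟩
    have := hw.2.2 u
    by_cases hu : u = a
    · subst hu; simp; omega
    · simpa [hu] using this
  · intro w hw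
    rw [mem_positiveWeights, Finset.sum_insert ha] at hw
    have : n - (n - w a) = w a := by omega
    simp [this]
  · rintro ⟨j, w⟩ hw
    simp only [mem_sigma, mem_range, mem_positiveWeights] at hw
    have h0 : w a = 0 := by
      by_contra h
      exact ha ((hw.2.2 a).1 h)
    have hj : n - (n - j) = j := by omega
    have hu : Function.update w a 0 = w := by
      rw [← h0, Function.update_eq_self]
    simp [hj, hu]
  · intro w hw
    simp [Function.update_of_ne hv]

/-- The total weight of a point over all positive weights on `s` of total weight `n`. -/
lemma sum_positiveWeights {ι : Type*} [DecidableEq ι] {s : Finset ι} {v : ι} (hv : v ∈ s)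
    (n : ℕ) : ∑ w ∈ positiveWeights s n, w v = n.choose s.card := by
  obtain ⟨t, ht, rfl⟩ : ∃ t, v ∉ t ∧ s = insert v t :=
    ⟨s.erase v, by simp, by simp [Finset.insert_erase hv]⟩
  clear hv
  induction t using Finset.induction_on generalizing n with
  | empty =>
    rcases Nat.eq_zero_or_pos n with rfl | hn
    · rw [Finset.sum_eq_zero]
      · simp
      · intro w hw
        rw [mem_positiveWeights] at hw
        simpa using hw.1
    · have : positiveWeights (insert v (∅ : Finset ι)) n = {Pi.single v n} := by
        ext w
        rw [mem_positiveWeights]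
        simp only [insert_empty_eq, sum_singleton, mem_singleton]
        constructor
        · rintro ⟨h1, h2⟩
          ext u
          by_cases hu : u = v
          · subst hu; simpa using h1
          · simpa [hu] using h2 u
        · rintro rfl
          refine ⟨by simp, fun u => ?_⟩
          by_cases hu : u = v
          · subst hu; simp; omega
          · simp [hu]
      rw [this]
      simp
  | insert a t ha ih =>
    have hva : v ≠ a := by rintro rfl; simp at ht
    have hvt : v ∉ t := fun h => ht (by simp [h])
    rw [Finset.insert_comm, sum_positiveWeights_insert (by simp [ha, hva.symm]) n hva,
      Finset.sum_congr rfl (fun j _ => ih j hvt),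
      Finset.card_insert_of_notMem (s := insert v t) (by simp [ha, hva.symm])]
    rw [Finset.card_insert_of_notMem hvt]
    clear ih
    -- What is left is the hockey-stick identity for the sum of `j.choose (t.card + 1)` over `j <
    -- n`.
    induction n with
    | zero => simp
    | succ n ih => rw [Finset.sum_range_succ, ih, Nat.choose_succ_succ' n (t.card + 1), add_comm]

/-! ### Faces of a simplicial complex -/

section Faces

variable {E : Type*} [AddCommGroup E] [Module ℝ E] {K : Geometry.SimplicialComplex ℝ E}

/-- Barycentric coordinates with respect to a face are unique. -/
lemma weights_unique {s : Finset E} (hs : s ∈ K.faces) {w w' : E → ℝ}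
    (h1 : ∑ v ∈ s, w v = ∑ v ∈ s, w' v) (h2 : ∑ v ∈ s, w v • v = ∑ v ∈ s, w' v • v) :
    ∀ v ∈ s, w v = w' v := by
  have hi := affineIndependent_iff.1 (K.indep hs) Finset.univ (fun v => w v - w' v)
  intro v hv
  have := hi (by
    rw [Finset.sum_coe_sort s (fun v => w v - w' v), Finset.sum_sub_distrib, h1, sub_self]) (by
    rw [Finset.sum_coe_sort s (fun v => (w v - w' v) • v)]
    simp only [sub_smul]
    rw [Finset.sum_sub_distrib, h2, sub_self]) ⟨v, hv⟩ (Finset.mem_univ _)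
  exact sub_eq_zero.1 this

/-- A face meeting another one in a relatively interior point is contained in it. -/
lemma subset_of_mem_convexHull {s t : Finset E} (hs : s ∈ K.faces) (ht : t ∈ K.faces) {w : E → ℝ}
    (hw : ∀ v ∈ s, 0 < w v) (h1 : ∑ v ∈ s, w v = 1)
    (h2 : ∑ v ∈ s, w v • v ∈ convexHull ℝ (t : Set E)) : s ⊆ t := by
  classical
  have hmem : ∑ v ∈ s, w v • v ∈ convexHull ℝ ((s ∩ t : Finset E) : Set E) := by
    rw [Finset.coe_inter]
    exact K.inter_subset_convexHull hs ht
      ⟨Finset.mem_convexHull'.2 ⟨w, fun v hv => (hw v hv).le, h1, rfl⟩, h2⟩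
  obtain ⟨w', -, h1', h2'⟩ := Finset.mem_convexHull'.1 hmem
  -- Extended by zero from `s ∩ t`, the second family also gives coordinates on `s`; uniqueness
  -- makes `w` vanish off `t`, against positivity.
  have key := weights_unique hs (w := w) (w' := fun v => if v ∈ t then w' v else 0)
    (by rw [← Finset.sum_filter, Finset.filter_mem_eq_inter, h1', h1])
    (by simp only [ite_smul, zero_smul]
        rw [← Finset.sum_filter, Finset.filter_mem_eq_inter, h2'])
  intro v hv
  by_contra hvt
  have := key v hv
  rw [if_neg hvt] at this
  exact (hw v hv).ne' this

/-- Every point of the space of a simplicial complex is in the relative interior of a face. -/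
lemma exists_face_pos {p : E} (hp : p ∈ K.space) : ∃ s ∈ K.faces, ∃ w : E → ℝ,
    (∀ v ∈ s, 0 < w v) ∧ ∑ v ∈ s, w v = 1 ∧ ∑ v ∈ s, w v • v = p := by
  classical
  obtain ⟨t, ht, hpt⟩ := Geometry.SimplicialComplex.mem_space_iff.1 hp
  obtain ⟨w, h0, h1, h2⟩ := Finset.mem_convexHull'.1 hpt
  have e1 : ∑ v ∈ t with 0 < w v, w v = 1 := by
    rw [Finset.sum_filter_of_ne, h1]
    exact fun v hv h => lt_of_le_of_ne (h0 v hv) h.symm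
  refine ⟨t.filter (fun v => 0 < w v), K.down_closed ht (Finset.filter_subset _ _) ?_, w,
    fun v hv => (Finset.mem_filter.1 hv).2, e1, ?_⟩
  · by_contra h
    rw [Finset.not_nonempty_iff_eq_empty] at h
    rw [h] at e1
    simp at e1
  · rw [Finset.sum_filter_of_ne, h2]
    exact fun v hv h => lt_of_le_of_ne (h0 v hv) (fun h' => h (by rw [← h', zero_smul]))

lemma exists_facet {s : Finset E} (hfin : K.faces.Finite) (hs : s ∈ K.faces) :
    ∃ t ∈ K.facets, s ⊆ t := by
  obtain ⟨t, hst, ht⟩ := hfin.exists_le_maximal hs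
  exact ⟨t, ⟨ht.prop, fun u hu htu => ht.eq_of_le hu htu⟩, hst⟩

end Faces

/-! ### Determinants and areas of triangles -/

/-- The determinant of two vectors of the plane. -/
def cross (u v : Fin 2 → ℝ) : ℝ := u 0 * v 1 - u 1 * v 0

lemma measurableSet_unitTriangle :
    MeasurableSet {p : ℝ × ℝ | 0 ≤ p.1 ∧ 0 ≤ p.2 ∧ p.1 + p.2 ≤ 1} := by
  apply IsClosed.measurableSet
  apply IsClosed.inter (isClosed_le continuous_const continuous_fst)
  apply IsClosed.inter (isClosed_le continuous_const continuous_snd)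
  exact isClosed_le (continuous_fst.add continuous_snd) continuous_const

lemma volume_unitTriangle_prod :
    MeasureTheory.volume {p : ℝ × ℝ | 0 ≤ p.1 ∧ 0 ≤ p.2 ∧ p.1 + p.2 ≤ 1} = 1 / 2 := by
  rw [MeasureTheory.Measure.volume_eq_prod,
    MeasureTheory.Measure.prod_apply measurableSet_unitTriangle]
  have hsec : ∀ x : ℝ, MeasureTheory.volume
      (Prod.mk x ⁻¹' {p : ℝ × ℝ | 0 ≤ p.1 ∧ 0 ≤ p.2 ∧ p.1 + p.2 ≤ 1}) =
      (Set.Icc (0 : ℝ) 1).indicator (fun x => ENNReal.ofReal (1 - x)) x := by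
    intro x
    by_cases hx : x ∈ Set.Icc (0 : ℝ) 1
    · rw [Set.indicator_of_mem hx]
      have : (Prod.mk x ⁻¹' {p : ℝ × ℝ | 0 ≤ p.1 ∧ 0 ≤ p.2 ∧ p.1 + p.2 ≤ 1}) =
          Set.Icc 0 (1 - x) := by
        ext y
        simp only [Set.mem_preimage, Set.mem_ofPred_eq, Set.mem_Icc]
        constructor
        · rintro ⟨-, h1, h2⟩; exact ⟨h1, by linarith⟩
        · rintro ⟨h1, h2⟩; exact ⟨hx.1, h1, by linarith⟩
      rw [this, Real.volume_Icc, sub_zero]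
    · rw [Set.indicator_of_notMem hx]
      have : (Prod.mk x ⁻¹' {p : ℝ × ℝ | 0 ≤ p.1 ∧ 0 ≤ p.2 ∧ p.1 + p.2 ≤ 1}) = ∅ := by
        ext y
        simp only [Set.mem_preimage, Set.mem_ofPred_eq, Set.mem_empty_iff_false, iff_false]
        rintro ⟨h1, h2, h3⟩
        exact hx ⟨h1, by linarith⟩
      rw [this, MeasureTheory.measure_empty]
  simp_rw [hsec]
  rw [MeasureTheory.lintegral_indicator measurableSet_Icc,
    ← MeasureTheory.ofReal_integral_eq_lintegral_ofReal]
  · rw [MeasureTheory.integral_Icc_eq_integral_Ioc,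
      ← intervalIntegral.integral_of_le zero_le_one]
    have : ∫ x in (0 : ℝ)..1, (1 - x) = 1 / 2 := by
      rw [intervalIntegral.integral_sub (by simp) (by simp)]
      simp
      norm_num
    rw [this, ENNReal.ofReal_div_of_pos (by norm_num)]
    simp
  · exact (continuous_const.sub continuous_id).continuousOn.integrableOn_compact isCompact_Icc
  · filter_upwards [MeasureTheory.ae_restrict_mem measurableSet_Icc] with x hx
    simpa using hx.2

lemma volume_unitTriangle :
    MeasureTheory.volume {p : Fin 2 → ℝ | 0 ≤ p 0 ∧ 0 ≤ p 1 ∧ p 0 + p 1 ≤ 1} = 1 / 2 := by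
  rw [← volume_unitTriangle_prod,
    ← (MeasureTheory.volume_preserving_finTwoArrow ℝ).measure_preimage
      measurableSet_unitTriangle.nullMeasurableSet]
  rfl

lemma sum_triple {E M : Type*} [DecidableEq E] [AddCommMonoid M] {a b c : E} (hab : a ≠ b)
    (hac : a ≠ c) (hbc : b ≠ c) (f : E → M) :
    ∑ x ∈ ({a, b, c} : Finset E), f x = f a + (f b + f c) := by
  rw [Finset.sum_insert (by simp [hab, hac]), Finset.sum_pair hbc]

lemma ne_of_card_triple {E : Type*} [DecidableEq E] {a b c : E}
    (h : ({a, b, c} : Finset E).card = 3) : a ≠ b ∧ a ≠ c ∧ b ≠ c := by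
  refine ⟨?_, ?_, ?_⟩ <;> rintro rfl
  · have := Finset.card_le_two (a := a) (b := c)
    simp at h; omega
  · have := Finset.card_le_two (a := b) (b := a)
    simp [Finset.insert_comm a b] at h; omega
  · have := Finset.card_le_two (a := a) (b := b)
    simp at h; omega

/-- Membership in a triangle in terms of coordinates based at a vertex. -/
lemma mem_convexHull_triple {E : Type*} [AddCommGroup E] [Module ℝ E] {a b c p : E}
    (hab : a ≠ b) (hac : a ≠ c) (hbc : b ≠ c) :
    p ∈ convexHull ℝ ({a, b, c} : Set E) ↔
      ∃ u v : ℝ, 0 ≤ u ∧ 0 ≤ v ∧ u + v ≤ 1 ∧ a + (u • (b - a) + v • (c - a)) = p := by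
  classical
  have hcoe : ({a, b, c} : Set E) = (({a, b, c} : Finset E) : Set E) := by simp
  rw [hcoe, Finset.mem_convexHull']
  constructor
  · rintro ⟨w, h0, h1, rfl⟩
    rw [sum_triple hab hac hbc] at h1
    rw [sum_triple hab hac hbc]
    have ha := h0 a (by simp)
    refine ⟨w b, w c, h0 b (by simp), h0 c (by simp), by linarith, ?_⟩
    have : w a = 1 - w b - w c := by linarith
    rw [this]
    module
  · rintro ⟨u, v, hu, hv, huv, rfl⟩
    refine ⟨fun x => if x = a then 1 - u - v else if x = b then u else v, ?_, ?_, ?_⟩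
    · intro y _
      dsimp only
      split_ifs <;> linarith
    · rw [sum_triple hab hac hbc]
      simp [hab.symm, hac.symm, hbc.symm]
    · rw [sum_triple hab hac hbc]
      simp only [hab.symm, hac.symm, hbc.symm, if_true, if_false]
      module

/-- The triangle is a translate of the linear image of the standard one, which has area `1/2`; the
map has columns `b - a` and `c - a`. -/
lemma volume_convexHull_triple {a b c : Fin 2 → ℝ} (hab : a ≠ b) (hac : a ≠ c) (hbc : b ≠ c) :
    MeasureTheory.volume (convexHull ℝ ({a, b, c} : Set (Fin 2 → ℝ))) =
      ENNReal.ofReal |cross (b - a) (c - a)| * (1 / 2) := by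
  set M : Matrix (Fin 2) (Fin 2) ℝ := !![(b - a) 0, (c - a) 0; (b - a) 1, (c - a) 1] with hM
  have himg : convexHull ℝ ({a, b, c} : Set (Fin 2 → ℝ)) =
      (fun x => a + x) '' (Matrix.toLin' M ''
        {p : Fin 2 → ℝ | 0 ≤ p 0 ∧ 0 ≤ p 1 ∧ p 0 + p 1 ≤ 1}) := by
    have hlin : ∀ p : Fin 2 → ℝ, Matrix.toLin' M p = p 0 • (b - a) + p 1 • (c - a) := by
      intro p
      ext i
      fin_cases i <;> simp [hM, Matrix.mulVec, dotProduct, Fin.sum_univ_two] <;> ring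
    ext p
    rw [mem_convexHull_triple hab hac hbc]
    simp only [Set.mem_image, Set.mem_ofPred_eq, hlin]
    constructor
    · rintro ⟨u, v, hu, hv, huv, rfl⟩
      exact ⟨_, ⟨![u, v], ⟨by simpa using hu, by simpa using hv, by simpa using huv⟩, rfl⟩,
        by simp⟩
    · rintro ⟨_, ⟨q, ⟨h0, h1, h2⟩, rfl⟩, rfl⟩
      exact ⟨q 0, q 1, h0, h1, h2, rfl⟩
  have hdet : M.det = cross (b - a) (c - a) := by
    rw [hM, Matrix.det_fin_two_of, cross]
    ring
  rw [himg, Set.image_add_left, MeasureTheory.measure_preimage_add,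
    MeasureTheory.Measure.addHaar_image_linearMap, LinearMap.det_toLin', hdet,
    volume_unitTriangle]

/-- A facet of a unimodular triangulation is a triangle of determinant `±1`. -/
lemma IsUnimodularTriangulation.facet_eq {K : Geometry.SimplicialComplex ℝ (Fin 2 → ℝ)}
    {P : Set (Fin 2 → ℝ)} (hK : IsUnimodularTriangulation K P) {t : Finset (Fin 2 → ℝ)}
    (ht : t ∈ K.facets) : t.card = 3 ∧
      ∀ a b c, t = {a, b, c} → |cross (b - a) (c - a)| = 1 := by
  have hvol := hK.area_eq t ht
  have hcard : t.card = 3 := by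
    by_contra hne
    have hind := K.indep ht.1
    -- Affinely independent points span the plane only if there are three of them; otherwise the
    -- hull lies in a null affine subspace.
    have h1 : affineSpan ℝ (t : Set (Fin 2 → ℝ)) ≠ ⊤ := by
      intro h
      have := hind.affineSpan_eq_top_iff_card_eq_finrank_add_one.1 (by simpa using h)
      simp at this
      exact hne this
    have h2 : MeasureTheory.volume (convexHull ℝ (t : Set (Fin 2 → ℝ))) = 0 :=
      MeasureTheory.measure_mono_null (convexHull_subset_affineSpan _)
        (MeasureTheory.Measure.addHaar_affineSubspace _ _ h1)
    rw [h2] at hvol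
    exact (ENNReal.half_pos one_ne_zero).ne hvol
  refine ⟨hcard, ?_⟩
  rintro a b c rfl
  obtain ⟨hab, hac, hbc⟩ := ne_of_card_triple hcard
  simp only [Finset.coe_insert, Finset.coe_singleton] at hvol
  rw [volume_convexHull_triple hab hac hbc] at hvol
  have := congrArg ENNReal.toReal hvol
  simpa using this

/-! ### Lattice points of dilates through barycentric coordinates -/

section Lattice

variable {K : Geometry.SimplicialComplex ℝ (Fin 2 → ℝ)} {P : Set (Fin 2 → ℝ)}

lemma IsUnimodularTriangulation.exists_triangle (hK : IsUnimodularTriangulation K P)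
    {s : Finset (Fin 2 → ℝ)} (hs : s ∈ K.faces) {x : Fin 2 → ℝ} (hx : x ∈ s) :
    ∃ a c, {x, a, c} ∈ K.facets ∧ x ≠ a ∧ x ≠ c ∧ a ≠ c ∧ s ⊆ {x, a, c} := by
  obtain ⟨t, ht, hst⟩ := exists_facet hK.finite_faces hs
  obtain ⟨hcard, -⟩ := hK.facet_eq ht
  have hc2 : (t.erase x).card = 2 := by rw [Finset.card_erase_of_mem (hst hx), hcard]
  obtain ⟨a, c, hac, he⟩ := Finset.card_eq_two.1 hc2
  have hte : t = {x, a, c} := by rw [← he, Finset.insert_erase (hst hx)]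
  subst hte
  obtain ⟨h1, h2, h3⟩ := ne_of_card_triple hcard
  exact ⟨a, c, ht, h1, h2, h3, hst⟩

/-- Barycentric coordinates of lattice points with respect to unimodular simplices are integral. -/
lemma IsUnimodularTriangulation.exists_int_weight (hK : IsUnimodularTriangulation K P)
    {s : Finset (Fin 2 → ℝ)} (hs : s ∈ K.faces) {w : (Fin 2 → ℝ) → ℝ} {n : ℤ}
    (h1 : ∑ v ∈ s, w v = n) (h2 : ∀ i, ∃ k : ℤ, (∑ v ∈ s, w v • v) i = k)
    {v : Fin 2 → ℝ} (hv : v ∈ s) : ∃ k : ℤ, w v = k := by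
  obtain ⟨a, c, ht, hva, hvc, hac, hst⟩ := hK.exists_triangle hs hv
  have hcross := (hK.facet_eq ht).2 c v a (by ext; simp; tauto)
  have hlat := hK.vertices_lattice _ ht.1
  have e1 : ∑ u ∈ ({v, a, c} : Finset (Fin 2 → ℝ)), (if u ∈ s then w u else 0) = n := by
    rw [← Finset.sum_filter, Finset.filter_mem_eq_inter, Finset.inter_eq_right.2 hst, h1]
  have e2 : ∑ u ∈ ({v, a, c} : Finset (Fin 2 → ℝ)), (if u ∈ s then w u else 0) • u =
      ∑ v ∈ s, w v • v := by
    simp only [ite_smul, zero_smul]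
    rw [← Finset.sum_filter, Finset.filter_mem_eq_inter, Finset.inter_eq_right.2 hst]
  rw [sum_triple hva hvc hac] at e1 e2
  rw [if_pos hv] at e1 e2
  generalize (if a ∈ s then w a else 0) = α at e1 e2
  generalize (if c ∈ s then w c else 0) = γ at e1 e2
  rw [← e2] at h2
  obtain ⟨p0, hp0⟩ := h2 0
  obtain ⟨p1, hp1⟩ := h2 1
  obtain ⟨a0, ha0⟩ := hlat a (by simp) 0
  obtain ⟨a1, ha1⟩ := hlat a (by simp) 1
  obtain ⟨c0, hc0⟩ := hlat c (by simp) 0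
  obtain ⟨c1, hc1⟩ := hlat c (by simp) 1
  -- Cramer's rule based at `c`: the given point minus `n • c` equals `w v • (v - c) + α • (a - c)`,
  -- and pairing with `a - c` kills the second term.
  have key : w v * cross (v - c) (a - c) =
      (((p0 - n * c0) * (a1 - c1) - (p1 - n * c1) * (a0 - c0) : ℤ) : ℝ) := by
    push_cast
    rw [← hp0, ← hp1, ← ha0, ← ha1, ← hc0, ← hc1, ← e1]
    simp only [cross, Pi.sub_apply, Pi.add_apply, Pi.smul_apply, smul_eq_mul]
    ring
  rcases eq_or_eq_neg_of_abs_eq hcross with h | h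
  · rw [h, mul_one] at key
    exact ⟨_, key⟩
  · rw [h, mul_neg, mul_one] at key
    exact ⟨-((p0 - n * c0) * (a1 - c1) - (p1 - n * c1) * (a0 - c0)), by
      rw [Int.cast_neg, ← key, neg_neg]⟩

/-- The lattice points of a unimodularly triangulated set are the vertices. -/
lemma IsUnimodularTriangulation.mem_latticePoints_iff (hK : IsUnimodularTriangulation K P)
    {x : Fin 2 → ℝ} : x ∈ latticePoints P ↔ {x} ∈ K.faces := by
  constructor
  · rintro ⟨hxP, hx⟩
    rw [← hK.space_eq] at hxP
    obtain ⟨s, hs, w, hpos, h1, rfl⟩ := exists_face_pos hxP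
    -- Positive integral weights of sum 1 leave room for only one vertex.
    have hw : ∀ v ∈ s, 1 ≤ w v := by
      intro v hv
      obtain ⟨k, hk⟩ := hK.exists_int_weight hs (n := 1) (by simpa using h1) hx hv
      have := hpos v hv
      rw [hk] at this ⊢
      exact_mod_cast Int.add_one_le_iff.2 (Int.cast_pos.1 this)
    have hc : (s.card : ℝ) ≤ 1 := by
      rw [← h1]
      simpa using Finset.card_nsmul_le_sum s w 1 hw
    have hc1 : s.card = 1 := by
      have := (K.nonempty_of_mem_faces hs).card_pos
      have : s.card ≤ 1 := by exact_mod_cast hc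
      omega
    obtain ⟨a, rfl⟩ := Finset.card_eq_one.1 hc1
    rw [Finset.sum_singleton] at h1
    simpa [h1] using hs
  · intro hx
    refine ⟨?_, hK.vertices_lattice _ hx x (by simp)⟩
    rw [← hK.space_eq]
    exact K.subset_space hx (by simp)

/-- The lattice points of `nP`, sorted by the faces of a unimodular triangulation. -/
lemma IsUnimodularTriangulation.latticePoints_smul (hK : IsUnimodularTriangulation K P) {n : ℕ}
    (hn : n ≠ 0) : latticePoints ((n : ℝ) • P) =
      (fun x : (_ : Finset (Fin 2 → ℝ)) × ((Fin 2 → ℝ) → ℕ) => ∑ v ∈ x.1, (x.2 v : ℝ) • v) ''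
        (hK.finite_faces.toFinset.sigma fun s => positiveWeights s n :
          Set ((_ : Finset (Fin 2 → ℝ)) × ((Fin 2 → ℝ) → ℕ))) := by
  have hn' : (n : ℝ) ≠ 0 := by exact_mod_cast hn
  have hn0 : (0 : ℝ) < n := by positivity
  ext p
  simp only [Set.mem_image, Finset.mem_coe, Finset.mem_sigma, Set.Finite.mem_toFinset,
    mem_positiveWeights, Sigma.exists]
  constructor
  · rintro ⟨⟨q, hq, rfl⟩, hlat⟩
    rw [← hK.space_eq] at hq
    obtain ⟨s, hs, w, hpos, h1, rfl⟩ := exists_face_pos hq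
    have hsm : (n : ℝ) • ∑ v ∈ s, w v • v = ∑ v ∈ s, (n * w v) • v := by
      simp only [Finset.smul_sum, smul_smul]
    have hnat : ∀ v ∈ s, ∃ k : ℕ, n * w v = k := by
      intro v hv
      obtain ⟨k, hk⟩ := hK.exists_int_weight hs (w := fun v => n * w v) (n := n)
        (by rw [← Finset.mul_sum, h1]; simp) (by rw [← hsm]; exact hlat) hv
      have h0 : (0 : ℝ) ≤ k := by rw [← hk]; have := hpos v hv; positivity
      lift k to ℕ using (by exact_mod_cast h0)
      exact ⟨k, by exact_mod_cast hk⟩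
    choose! k hk using hnat
    refine ⟨s, fun v => if v ∈ s then k v else 0, ⟨hs, ?_, ?_⟩, ?_⟩
    · have : ∑ v ∈ s, (k v : ℝ) = n := by
        rw [← Finset.sum_congr rfl hk, ← Finset.mul_sum, h1, mul_one]
      rw [Finset.sum_congr rfl fun v hv => if_pos hv]
      exact_mod_cast this
    · intro v
      by_cases hv : v ∈ s
      · have h0 : (0 : ℝ) < k v := by rw [← hk v hv]; have := hpos v hv; positivity
        have h0' : 0 < k v := by exact_mod_cast h0
        simp [hv]; omega
      · simp [hv]
    · change _ = (n : ℝ) • ∑ v ∈ s, w v • v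
      rw [hsm]
      exact Finset.sum_congr rfl fun v hv => by simp only [if_pos hv]; rw [hk v hv]
  · rintro ⟨s, w, ⟨hs, h1, h2⟩, rfl⟩
    refine ⟨⟨∑ v ∈ s, ((w v : ℝ) / n) • v, ?_, ?_⟩, fun i => ?_⟩
    · rw [← hK.space_eq]
      refine K.convexHull_subset_space hs (Finset.mem_convexHull'.2
        ⟨_, fun v _ => by positivity, ?_, rfl⟩)
      rw [← Finset.sum_div, ← Nat.cast_sum, h1, div_self hn']
    · change (n : ℝ) • _ = _
      rw [Finset.smul_sum]
      refine Finset.sum_congr rfl fun v _ => ?_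
      rw [smul_smul, mul_div_cancel₀ _ hn']
    · choose! k hk using hK.vertices_lattice s hs
      refine ⟨∑ v ∈ s, w v * k v i, ?_⟩
      rw [Finset.sum_apply]
      push_cast
      exact Finset.sum_congr rfl fun v hv => by rw [Pi.smul_apply, hk v hv i, smul_eq_mul]

/-- After division by `n`, equal sums are one point relatively interior to both faces. Hence each
face contains the other, and barycentric coordinates are unique. -/
lemma IsUnimodularTriangulation.injOn_weights (hK : IsUnimodularTriangulation K P) {n : ℕ}
    (hn : n ≠ 0) : Set.InjOn
      (fun x : (_ : Finset (Fin 2 → ℝ)) × ((Fin 2 → ℝ) → ℕ) => ∑ v ∈ x.1, (x.2 v : ℝ) • v)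
        (hK.finite_faces.toFinset.sigma fun s => positiveWeights s n :
          Set ((_ : Finset (Fin 2 → ℝ)) × ((Fin 2 → ℝ) → ℕ))) := by
  have hn' : (n : ℝ) ≠ 0 := by exact_mod_cast hn
  have hsub : ∀ {s s' : Finset (Fin 2 → ℝ)} {w w' : (Fin 2 → ℝ) → ℕ}, s ∈ K.faces → s' ∈ K.faces →
      w ∈ positiveWeights s n → w' ∈ positiveWeights s' n →
      ∑ v ∈ s, (w v : ℝ) • v = ∑ v ∈ s', (w' v : ℝ) • v → s ⊆ s' := by
    intro s s' w w' hs hs' hw hw' h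
    rw [mem_positiveWeights] at hw hw'
    have hscale : ∀ (u : Finset (Fin 2 → ℝ)) (f : (Fin 2 → ℝ) → ℕ),
        ∑ v ∈ u, ((f v : ℝ) / n) • v = (n : ℝ)⁻¹ • ∑ v ∈ u, (f v : ℝ) • v := by
      intro u f
      simp only [Finset.smul_sum, smul_smul, div_eq_inv_mul]
    refine subset_of_mem_convexHull hs hs' (w := fun v => (w v : ℝ) / n) (fun v hv => ?_) ?_ ?_
    · have := Nat.pos_of_ne_zero ((hw.2 v).2 hv)
      positivity
    · rw [← Finset.sum_div, ← Nat.cast_sum, hw.1, div_self hn']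
    · rw [hscale, h, ← hscale]
      refine Finset.mem_convexHull'.2 ⟨_, fun v _ => by positivity, ?_, rfl⟩
      rw [← Finset.sum_div, ← Nat.cast_sum, hw'.1, div_self hn']
  rintro ⟨s, w⟩ hx ⟨s', w'⟩ hx' h
  simp only [Finset.mem_coe, Finset.mem_sigma, Set.Finite.mem_toFinset] at hx hx' h
  obtain rfl : s = s' := (hsub hx.1 hx'.1 hx.2 hx'.2 h).antisymm (hsub hx'.1 hx.1 hx'.2 hx.2 h.symm)
  have hw := mem_positiveWeights.1 hx.2
  have hw' := mem_positiveWeights.1 hx'.2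
  have := weights_unique hx.1 (w := fun v => (w v : ℝ)) (w' := fun v => (w' v : ℝ))
    (by rw [← Nat.cast_sum, ← Nat.cast_sum, hw.1, hw'.1]) h
  congr 1
  ext v
  by_cases hv : v ∈ s
  · exact_mod_cast this v hv
  · rw [not_not.1 (mt (hw.2 v).1 hv), not_not.1 (mt (hw'.2 v).1 hv)]

/-- The discrete moment vector of `nP` as a sum over the faces of a unimodular triangulation. -/
lemma IsUnimodularTriangulation.discreteMomentVector_smul (hK : IsUnimodularTriangulation K P)
    {n : ℕ} (hn : n ≠ 0) : discreteMomentVector ((n : ℝ) • P) =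
      ∑ s ∈ hK.finite_faces.toFinset, ∑ v ∈ s, (n.choose s.card : ℝ) • v := by
  rw [discreteMomentVector, hK.latticePoints_smul hn, finsum_mem_image (hK.injOn_weights hn),
    finsum_mem_coe_finset, Finset.sum_sigma]
  refine Finset.sum_congr rfl fun s _ => ?_
  dsimp only
  rw [Finset.sum_comm]
  refine Finset.sum_congr rfl fun v hv => ?_
  rw [← Finset.sum_smul, ← sum_positiveWeights hv, Nat.cast_sum]

end Lattice

/-! ### Supporting lines, edges and their adjacent triangles -/

section Local

lemma cross_add_right (u v w : Fin 2 → ℝ) : cross u (v + w) = cross u v + cross u w := by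
  simp only [cross, Pi.add_apply]; ring

lemma cross_smul_right (u v : Fin 2 → ℝ) (r : ℝ) : cross u (r • v) = r * cross u v := by
  simp only [cross, Pi.smul_apply, smul_eq_mul]; ring

lemma cross_smul_left (u v : Fin 2 → ℝ) (r : ℝ) : cross (r • u) v = r * cross u v := by
  simp only [cross, Pi.smul_apply, smul_eq_mul]; ring

lemma cross_self (u : Fin 2 → ℝ) : cross u u = 0 := by
  simp only [cross]; ring

lemma cross_swap (u v : Fin 2 → ℝ) : cross u v = -cross v u := by
  simp only [cross]; ring

/-- Cramer's rule in the plane. -/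
lemma eq_smul_add_smul {u v : Fin 2 → ℝ} (h : cross u v ≠ 0) (w : Fin 2 → ℝ) :
    w = (cross w v / cross u v) • u + (cross u w / cross u v) • v := by
  ext i
  simp only [Pi.add_apply, Pi.smul_apply, smul_eq_mul]
  field_simp
  fin_cases i <;> simp [cross] <;> ring

lemma exists_eq_smul_of_cross_eq_zero {u v : Fin 2 → ℝ} (hu : u ≠ 0) (h : cross u v = 0) :
    ∃ k : ℝ, v = k • u := by
  have hne : u 0 ^ 2 + u 1 ^ 2 ≠ 0 := by
    intro h0
    apply hu
    ext i
    fin_cases i <;> simp <;> nlinarith [sq_nonneg (u 0), sq_nonneg (u 1)]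
  refine ⟨(u 0 * v 0 + u 1 * v 1) / (u 0 ^ 2 + u 1 ^ 2), ?_⟩
  simp only [cross] at h
  ext i
  simp only [Pi.smul_apply, smul_eq_mul]
  rw [div_mul_eq_mul_div, eq_div_iff hne]
  fin_cases i <;> simp
  · linear_combination (-u 1) * h
  · linear_combination (u 0) * h

variable {K : Geometry.SimplicialComplex ℝ (Fin 2 → ℝ)} {P : Set (Fin 2 → ℝ)}

lemma IsLatticePolygon.convex (hP : IsLatticePolygon P) : Convex ℝ P := by
  obtain ⟨⟨s, -, rfl⟩, -⟩ := hP
  exact convex_convexHull ℝ _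

lemma IsLatticePolygon.interior_nonempty (hP : IsLatticePolygon P) : (interior P).Nonempty :=
  hP.convex.interior_nonempty_iff_affineSpan_eq_top.2 hP.2

/-- A point of the boundary of a polygon has a supporting line. -/
lemma IsLatticePolygon.exists_support (hP : IsLatticePolygon P) {x : Fin 2 → ℝ}
    (hx : x ∉ interior P) : ∃ d : Fin 2 → ℝ, d ≠ 0 ∧ ∀ p ∈ P, 0 ≤ cross d (p - x) := by
  obtain ⟨f, u, hf, h1, h2⟩ := geometric_hahn_banach_of_nonempty_interior hP.convex
    (convex_singleton x) (Set.disjoint_singleton_right.2 hx) hP.interior_nonempty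
    (Set.singleton_nonempty x)
  have hfv : ∀ v : Fin 2 → ℝ, f v = v 0 * f (Pi.single 0 1) + v 1 * f (Pi.single 1 1) := by
    intro v
    have : v = v 0 • Pi.single 0 1 + v 1 • Pi.single 1 1 := by
      ext i; fin_cases i <;> simp
    conv_lhs => rw [this]
    simp
  -- Rotating the gradient of `f` by a right angle expresses `-f` as a determinant.
  have hcr : ∀ v, cross ![-f (Pi.single 1 1), f (Pi.single 0 1)] v = - f v := by
    intro v
    rw [hfv v]
    simp [cross]
    ring
  refine ⟨![-f (Pi.single 1 1), f (Pi.single 0 1)], ?_, ?_⟩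
  · intro h0
    apply hf
    ext v
    have := hcr v
    rw [h0] at this
    simp [cross] at this
    simpa using this
  · intro p hp
    rw [hcr, map_sub]
    have := h1 p hp
    have := h2 x rfl
    linarith

lemma exists_smul_mem_of_mem_interior {x : Fin 2 → ℝ} (hx : x ∈ interior P) (w : Fin 2 → ℝ) :
    ∃ ε : ℝ, 0 < ε ∧ x + ε • w ∈ P := by
  have hc : Filter.Tendsto (fun ε : ℝ => x + ε • w) (nhdsWithin 0 (Set.Ioi 0)) (nhds x) := by
    have : Continuous fun ε : ℝ => x + ε • w := by fun_prop
    simpa using (this.tendsto 0).mono_left nhdsWithin_le_nhds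
  have h1 := hc.eventually (mem_interior_iff_mem_nhds.1 hx)
  obtain ⟨ε, h, hε⟩ := (h1.and self_mem_nhdsWithin).exists
  exact ⟨ε, hε, h⟩

lemma notMem_interior_of_side {x d : Fin 2 → ℝ} (hd : d ≠ 0)
    (h : ∀ p ∈ P, 0 ≤ cross d (p - x)) : x ∉ interior P := by
  intro hx
  -- Moving from `x` along `d` turned clockwise gives determinant `-ε|d|²`, which leaves the
  -- half-plane.
  obtain ⟨ε, hε, hmem⟩ := exists_smul_mem_of_mem_interior hx ![d 1, -d 0]
  have h1 := h _ hmem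
  rw [add_sub_cancel_left, cross_smul_right] at h1
  have h2 : cross d ![d 1, -d 0] ≤ 0 := by
    simp [cross]; nlinarith [sq_nonneg (d 0), sq_nonneg (d 1)]
  have h3 : cross d ![d 1, -d 0] = 0 := le_antisymm h2 (nonneg_of_mul_nonneg_right h1 hε)
  apply hd
  simp [cross] at h3
  ext i
  fin_cases i <;> simp <;> nlinarith [sq_nonneg (d 0), sq_nonneg (d 1)]

/-- Otherwise `P` would lie in a line and have empty interior. -/
lemma IsLatticePolygon.exists_cross_ne_zero (hP : IsLatticePolygon P) (x : Fin 2 → ℝ)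
    {d : Fin 2 → ℝ} (hd : d ≠ 0) : ∃ p ∈ P, cross d (p - x) ≠ 0 := by
  by_contra! h
  obtain ⟨q, hq⟩ := hP.interior_nonempty
  refine notMem_interior_of_side hd (x := q) (fun p hp => ?_) hq
  have h1 := h p hp
  have h2 := h q (interior_subset hq)
  have : cross d (p - q) = cross d (p - x) - cross d (q - x) := by
    simp only [cross, Pi.sub_apply]; ring
  rw [this, h1, h2, sub_zero]

/-- If `P` has a point strictly on one side of an edge, there is a triangle on that side. -/
lemma IsUnimodularTriangulation.exists_triangle_side (hK : IsUnimodularTriangulation K P)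
    (hP : IsLatticePolygon P) {σ : ℝ} {x y : Fin 2 → ℝ} (hxy : {x, y} ∈ K.faces) (hne : y ≠ x)
    {p : Fin 2 → ℝ} (hp : p ∈ P) (hpos : 0 < σ * cross (y - x) (p - x)) :
    ∃ z, {x, y, z} ∈ K.faces ∧ 0 < σ * cross (y - x) (z - x) := by
  set m : Fin 2 → ℝ := ∑ v ∈ ({x, y} : Finset (Fin 2 → ℝ)), (1 / 2 : ℝ) • v with hm
  have hm' : m = x + (1 / 2 : ℝ) • (y - x) := by
    rw [hm, Finset.sum_pair hne.symm]; module
  have hmP : m ∈ P := by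
    rw [← hK.space_eq]
    refine K.convexHull_subset_space hxy (Finset.mem_convexHull'.2
      ⟨fun _ => 1 / 2, fun _ _ => by norm_num, ?_, rfl⟩)
    rw [Finset.sum_pair hne.symm]; norm_num
  have hc : Filter.Tendsto (fun ε : ℝ => m + ε • (p - m)) (nhdsWithin 0 (Set.Ioi 0)) (nhds m) := by
    have : Continuous fun ε : ℝ => m + ε • (p - m) := by fun_prop
    simpa using (this.tendsto 0).mono_left nhdsWithin_le_nhds
  -- Faces are closed and finite in number, so a small push of the midpoint `m` towards `p` enters
  -- no face that misses `m`. The facet reached therefore contains `m`, hence the whole edge.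
  have hev : ∀ᶠ ε in nhdsWithin (0 : ℝ) (Set.Ioi 0), ∀ s ∈ K.faces,
      m ∉ convexHull ℝ (s : Set (Fin 2 → ℝ)) →
        m + ε • (p - m) ∉ convexHull ℝ (s : Set (Fin 2 → ℝ)) := by
    rw [Filter.eventually_all_finite hK.finite_faces]
    intro s _
    by_cases hms : m ∈ convexHull ℝ (s : Set (Fin 2 → ℝ))
    · simp [hms]
    · have hcl : IsClosed (convexHull ℝ (s : Set (Fin 2 → ℝ))) :=
        s.finite_toSet.isClosed_convexHull ℝ
      filter_upwards [hc.eventually (hcl.isOpen_compl.mem_nhds hms)] with ε hε _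
      exact hε
  have hev1 : ∀ᶠ ε in nhdsWithin (0 : ℝ) (Set.Ioi 0), ε < 1 :=
    nhdsWithin_le_nhds (Iio_mem_nhds one_pos)
  obtain ⟨ε, ⟨hε, hε1⟩, hε0⟩ := ((hev.and hev1).and self_mem_nhdsWithin).exists
  have hε0 : 0 < ε := hε0
  have hqP : m + ε • (p - m) ∈ P := hP.convex.add_smul_sub_mem hmP hp ⟨hε0.le, hε1.le⟩
  have hqpos : 0 < σ * cross (y - x) (m + ε • (p - m) - x) := by
    have : σ * cross (y - x) (m + ε • (p - m) - x) = ε * (σ * cross (y - x) (p - x)) := by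
      rw [hm']; simp only [cross, Pi.add_apply, Pi.sub_apply, Pi.smul_apply, smul_eq_mul]; ring
    rw [this]; positivity
  rw [← hK.space_eq] at hqP
  obtain ⟨s, hs, hqs⟩ := Geometry.SimplicialComplex.mem_space_iff.1 hqP
  obtain ⟨t, ht, hst⟩ := exists_facet hK.finite_faces hs
  have hqt : m + ε • (p - m) ∈ convexHull ℝ (t : Set (Fin 2 → ℝ)) := convexHull_mono hst hqs
  have hmt : m ∈ convexHull ℝ (t : Set (Fin 2 → ℝ)) := by
    by_contra h
    exact hε t ht.1 h hqt
  have hsub : {x, y} ⊆ t := subset_of_mem_convexHull hxy ht.1 (w := fun _ => 1 / 2)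
    (fun _ _ => by norm_num) (by rw [Finset.sum_pair hne.symm]; norm_num) hmt
  have hcard := (hK.facet_eq ht).1
  obtain ⟨z, hz⟩ : ∃ z, t \ {x, y} = {z} := by
    rw [← Finset.card_eq_one, Finset.card_sdiff_of_subset hsub, hcard, Finset.card_pair hne.symm]
  have hte : t = {x, y, z} := by
    rw [← Finset.union_sdiff_of_subset hsub, hz]
    ext; simp
  subst hte
  obtain ⟨h1, h2, h3⟩ := ne_of_card_triple hcard
  refine ⟨z, ht.1, ?_⟩
  simp only [Finset.coe_insert, Finset.coe_singleton] at hqt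
  obtain ⟨u, v, hu, hv, -, hq⟩ := (mem_convexHull_triple h1 h2 h3).1 hqt
  rw [← hq, add_sub_cancel_left, cross_add_right, cross_smul_right, cross_smul_right,
    cross_self] at hqpos
  nlinarith

/-- There is at most one triangle on each side of an edge. -/
lemma triangle_side_unique {σ : ℝ} {x y z z' : Fin 2 → ℝ} (hz : {x, y, z} ∈ K.faces)
    (hz' : {x, y, z'} ∈ K.faces) (h : 0 < σ * cross (y - x) (z - x))
    (h' : 0 < σ * cross (y - x) (z' - x)) : z' = z := by
  have aux : ∀ {z}, 0 < σ * cross (y - x) (z - x) → x ≠ y ∧ x ≠ z ∧ y ≠ z := by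
    intro z h
    refine ⟨?_, ?_, ?_⟩ <;> rintro rfl
    · simp [cross] at h
    · simp [cross] at h
    · simp [cross_self] at h
  obtain ⟨hxy, hxz, hyz⟩ := aux h
  obtain ⟨-, hxz', hyz'⟩ := aux h'
  have hne : cross (y - x) (z - x) ≠ 0 := by rintro h0; simp [h0] at h
  have hdec := eq_smul_add_smul hne (z' - x)
  have hγ : 0 < cross (y - x) (z' - x) / cross (y - x) (z - x) := by
    have : cross (y - x) (z' - x) / cross (y - x) (z - x) =
        (σ * cross (y - x) (z' - x)) / (σ * cross (y - x) (z - x)) := by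
      rw [mul_div_mul_left]
      rintro rfl; simp at h
    rw [this]; positivity
  set γ := cross (y - x) (z' - x) / cross (y - x) (z - x)
  set β := cross (z' - x) (z - x) / cross (y - x) (z - x)
  -- Small enough that the point with weights `1/2 - ε`, `1/2`, `ε` on `x, y, z'` also lies in the
  -- triangle on `x, y, z`, where its coordinates on `y, z` are `1/2 + εβ` and `εγ`.
  set ε : ℝ := 1 / (4 * (1 + |β| + γ)) with hε
  have hD : 0 < 4 * (1 + |β| + γ) := by positivity
  have hε0 : 0 < ε := by positivity
  have hεD : ε + ε * |β| + ε * γ = 1 / 4 := by rw [hε]; field_simp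
  have hεβ : |ε * β| = ε * |β| := by rw [abs_mul, abs_of_pos hε0]
  have hb1 := neg_abs_le (ε * β)
  have hb2 := le_abs_self (ε * β)
  have hb3 : 0 < ε * γ := by positivity
  have hb4 : 0 ≤ ε * |β| := by positivity
  have hsub : ({x, y, z'} : Finset (Fin 2 → ℝ)) ⊆ {x, y, z} := by
    refine subset_of_mem_convexHull hz' hz
      (w := fun v => if v = x then 1 / 2 - ε else if v = y then 1 / 2 else ε) ?_ ?_ ?_
    · intro v _
      split_ifs <;> linarith
    · rw [sum_triple hxy hxz' hyz']
      simp [hxy.symm, hxz'.symm, hyz'.symm]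
      norm_num
    · rw [sum_triple hxy hxz' hyz']
      simp only [hxy.symm, hxz'.symm, hyz'.symm, if_true, if_false, Finset.coe_insert,
        Finset.coe_singleton]
      rw [mem_convexHull_triple hxy hxz hyz]
      refine ⟨1 / 2 + ε * β, ε * γ, by linarith, hb3.le, by linarith, ?_⟩
      have : x + ((1 / 2 + ε * β) • (y - x) + (ε * γ) • (z - x)) =
          x + ((1 / 2 : ℝ) • (y - x) + ε • (β • (y - x) + γ • (z - x))) := by module
      rw [this, ← hdec]
      module
  have := hsub (show z' ∈ _ by simp)
  simp only [Finset.mem_insert, Finset.mem_singleton] at this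
  rcases this with h | h | h
  · exact absurd h.symm hxz'
  · exact absurd h.symm hyz'
  · exact h

/-- Two edges at a vertex have different directions. -/
lemma edge_unique {x y y' : Fin 2 → ℝ} (hy : {x, y} ∈ K.faces) (hy' : {x, y'} ∈ K.faces)
    (hne' : y' ≠ x) {k : ℝ} (hk : 0 < k) (h : y' - x = k • (y - x)) : y' = y := by
  have hsub : ({x, y'} : Finset (Fin 2 → ℝ)) ⊆ {x, y} := by
    have hε : 0 < 1 / (1 + k) := by positivity
    have hε1 : 1 / (1 + k) < 1 := by rw [div_lt_one (by positivity)]; linarith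
    have hεk : 1 / (1 + k) + 1 / (1 + k) * k = 1 := by field_simp
    have hp : 0 < 1 / (1 + k) * k := by positivity
    -- The test point `x + (1/(1+k)) • (y' - x) = x + (k/(1+k)) • (y - x)` is inside both edges,
    -- whichever is longer.
    refine subset_of_mem_convexHull hy' hy
      (w := fun v => if v = x then 1 - 1 / (1 + k) else 1 / (1 + k)) ?_ ?_ ?_
    · intro v _
      split_ifs <;> linarith
    · rw [Finset.sum_pair hne'.symm]
      simp [hne']
    · rw [Finset.sum_pair hne'.symm]
      simp only [hne', if_true, if_false, Finset.coe_insert, Finset.coe_singleton,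
        convexHull_pair, segment_eq_image']
      refine ⟨1 / (1 + k) * k, ⟨hp.le, by linarith⟩, ?_⟩
      beta_reduce
      rw [mul_smul, ← h]
      module
  have := hsub (show y' ∈ _ by simp)
  simp only [Finset.mem_insert, Finset.mem_singleton] at this
  exact this.resolve_left hne'

/-- At most one edge at a vertex has the polygon on a given side. -/
lemma IsLatticePolygon.side_unique (hP : IsLatticePolygon P) {σ : ℝ} (hσ : σ ≠ 0)
    {x y y' : Fin 2 → ℝ} (hy : {x, y} ∈ K.faces) (hy' : {x, y'} ∈ K.faces)
    (hyP : y ∈ P) (hyP' : y' ∈ P) (hne : y ≠ x) (hne' : y' ≠ x)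
    (h : ∀ p ∈ P, σ * cross (y - x) (p - x) ≤ 0)
    (h' : ∀ p ∈ P, σ * cross (y' - x) (p - x) ≤ 0) : y' = y := by
  have hd : y - x ≠ 0 := sub_ne_zero.2 hne
  have h0 : cross (y - x) (y' - x) = 0 := by
    have h1 := h y' hyP'
    have h2 := h' y hyP
    rw [cross_swap, mul_neg] at h2
    exact (mul_eq_zero.1 (le_antisymm h1 (by linarith))).resolve_left hσ
  obtain ⟨k, hk⟩ := exists_eq_smul_of_cross_eq_zero hd h0
  rcases lt_trichotomy k 0 with hk0 | hk0 | hk0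
  -- Opposite directions would bound `P` on both sides of one line.
  · exfalso
    obtain ⟨p, hp, hpne⟩ := hP.exists_cross_ne_zero x hd
    apply hpne
    have h1 := h p hp
    have h2 := h' p hp
    rw [hk, cross_smul_left] at h2
    have h3 : 0 ≤ σ * cross (y - x) (p - x) := by nlinarith
    exact (mul_eq_zero.1 (le_antisymm h1 h3)).resolve_left hσ
  · rw [hk0, zero_smul, sub_eq_zero] at hk
    exact absurd hk hne'
  · exact edge_unique hy hy' hne' hk0 hk

/-- At a boundary vertex, there is an edge with the polygon on a given side. -/
lemma IsUnimodularTriangulation.exists_side (hK : IsUnimodularTriangulation K P)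
    (hP : IsLatticePolygon P) {σ : ℝ} (hσ : σ ≠ 0) {x : Fin 2 → ℝ} (hx : {x} ∈ K.faces)
    (hxP : x ∉ interior P) : ∃ y, {x, y} ∈ K.faces ∧ y ≠ x ∧
      ∀ p ∈ P, σ * cross (y - x) (p - x) ≤ 0 := by
  obtain ⟨d, hd, hsupp⟩ := hP.exists_support hxP
  -- `f` is the scaled height above the supporting line and `g` the scaled position along it,
  -- oriented by `σ`. By `hid`, the required `y` is the neighbour of extreme direction: `f y = 0 < g
  -- y`, or else maximal `g y / f y`.
  set f : (Fin 2 → ℝ) → ℝ := fun y => cross d (y - x) with hf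
  set g : (Fin 2 → ℝ) → ℝ := fun y => -σ * (d 0 * (y - x) 0 + d 1 * (y - x) 1) with hg
  have hid : ∀ y p, -(σ * cross (y - x) (p - x)) * (d 0 ^ 2 + d 1 ^ 2) =
      g y * f p - f y * g p := by
    intro y p
    simp only [hf, hg, cross]
    ring
  have hdd : 0 < d 0 ^ 2 + d 1 ^ 2 := by
    refine lt_of_le_of_ne (by positivity) fun h => hd ?_
    ext i
    fin_cases i <;> simp <;> nlinarith [sq_nonneg (d 0), sq_nonneg (d 1)]
  have hfin : {y | {x, y} ∈ K.faces ∧ y ≠ x}.Finite := by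
    refine (hK.finite_faces.biUnion fun s _ => s.finite_toSet).subset fun y hy => ?_
    simp only [Set.mem_iUnion]
    exact ⟨_, hy.1, by simp⟩
  have hmemP : ∀ {y}, {x, y} ∈ K.faces → y ∈ P := fun {y} h => by
    rw [← hK.space_eq]; exact K.subset_space h (by simp)
  by_cases hA : ∃ y, {x, y} ∈ K.faces ∧ y ≠ x ∧ f y = 0 ∧ 0 < g y
  · obtain ⟨y, hy, hne, hfy, hgy⟩ := hA
    refine ⟨y, hy, hne, fun p hp => ?_⟩
    have h1 := hid y p
    have h2 : 0 ≤ g y * f p := mul_nonneg hgy.le (hsupp p hp)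
    rw [hfy, zero_mul, sub_zero] at h1
    rw [← h1] at h2
    linarith [nonneg_of_mul_nonneg_left h2 hdd]
  · push Not at hA
    obtain ⟨a, c, ht, hxa, hxc, hac, -⟩ := hK.exists_triangle hx (Finset.mem_singleton_self x)
    have hxa' : {x, a} ∈ K.faces :=
      K.down_closed ht.1 (by intro u; simp; tauto) (by simp)
    have hxc' : {x, c} ∈ K.faces :=
      K.down_closed ht.1 (by intro u; simp; tauto) (by simp)
    -- If all neighbours had height zero, a triangle at `x` would be degenerate.
    have hne : {y | ({x, y} ∈ K.faces ∧ y ≠ x) ∧ 0 < f y}.Nonempty := by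
      by_contra hempty
      rw [Set.not_nonempty_iff_eq_empty, Set.eq_empty_iff_forall_notMem] at hempty
      have ha0 : f a = 0 := le_antisymm
        (not_lt.1 fun h => hempty a ⟨⟨hxa', hxa.symm⟩, h⟩) (hsupp a (hmemP hxa'))
      have hc0 : f c = 0 := le_antisymm
        (not_lt.1 fun h => hempty c ⟨⟨hxc', hxc.symm⟩, h⟩) (hsupp c (hmemP hxc'))
      have h1 := hid a c
      rw [ha0, hc0, mul_zero, zero_mul, sub_zero] at h1
      have h2 := (hK.facet_eq ht).2 x a c rfl
      have h3 : cross (a - x) (c - x) = 0 := by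
        simpa [hσ, hdd.ne'] using h1
      rw [h3] at h2
      simp at h2
    obtain ⟨y, ⟨⟨hy, hyx⟩, hfy⟩, hmax⟩ :=
      Set.exists_max_image _ (fun y => g y / f y) (hfin.subset fun y hy => hy.1) hne
    refine ⟨y, hy, hyx, fun p hp => ?_⟩
    by_contra! hpos
    -- A point of `P` beyond the extreme edge produces a triangle there, whose third vertex is a
    -- more extreme neighbour.
    obtain ⟨z, hz, hzpos⟩ := hK.exists_triangle_side hP hy hyx hp hpos
    have hxz : {x, z} ∈ K.faces :=
      K.down_closed hz (by intro u; simp; tauto) (by simp)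
    have hzx : z ≠ x := by
      rintro rfl
      simp [cross] at hzpos
    have h1 := hid y z
    have h2 : 0 < f y * g z - g y * f z := by nlinarith
    rcases (hsupp z (hmemP hxz)).lt_or_eq with hfz | hfz
    · have h3 := hmax z ⟨⟨hxz, hzx⟩, hfz⟩
      have hfz' : 0 < f z := hfz
      rw [div_le_div_iff₀ hfz' hfy] at h3
      linarith
    · have hfz' : f z = 0 := hfz.symm
      have h3 := hA z hxz hzx hfz'
      rw [hfz', mul_zero, sub_zero] at h2
      nlinarith

/-- An edge is in the boundary exactly when the polygon is on one side of it. -/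
lemma IsUnimodularTriangulation.openSegment_subset_frontier_iff
    (hK : IsUnimodularTriangulation K P) (hP : IsLatticePolygon P) {x y : Fin 2 → ℝ}
    (hxy : {x, y} ∈ K.faces) (hne : y ≠ x) : openSegment ℝ x y ⊆ frontier P ↔
      (∀ p ∈ P, (1 : ℝ) * cross (y - x) (p - x) ≤ 0) ∨
        ∀ p ∈ P, (-1 : ℝ) * cross (y - x) (p - x) ≤ 0 := by
  have hd : y - x ≠ 0 := sub_ne_zero.2 hne
  have hsub : segment ℝ x y ⊆ P := by
    have := K.convexHull_subset_space hxy
    rwa [hK.space_eq, Finset.coe_insert, Finset.coe_singleton, convexHull_pair] at this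
  constructor
  · intro h
    have hm : x + (1 / 2 : ℝ) • (y - x) ∈ openSegment ℝ x y := by
      rw [openSegment_eq_image']
      exact ⟨1 / 2, by norm_num, rfl⟩
    obtain ⟨d, hd0, hsupp⟩ := hP.exists_support (h hm).2
    have h1 := hsupp x (hsub (left_mem_segment ℝ x y))
    have h2 := hsupp y (hsub (right_mem_segment ℝ x y))
    have e1 : cross d (x - (x + (1 / 2 : ℝ) • (y - x))) = -(1 / 2) * cross d (y - x) := by
      simp only [cross, Pi.add_apply, Pi.sub_apply, Pi.smul_apply, smul_eq_mul]; ring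
    have e2 : cross d (y - (x + (1 / 2 : ℝ) • (y - x))) = (1 / 2) * cross d (y - x) := by
      simp only [cross, Pi.add_apply, Pi.sub_apply, Pi.smul_apply, smul_eq_mul]; ring
    rw [e1] at h1
    rw [e2] at h2
    -- The supporting line at the midpoint has both endpoints on the same weak side, so it runs
    -- along the edge.
    have h0 : cross (y - x) d = 0 := by rw [cross_swap]; linarith
    obtain ⟨k, hk⟩ := exists_eq_smul_of_cross_eq_zero hd h0
    have hkne : k ≠ 0 := by rintro rfl; simp at hk; exact hd0 hk
    have h3 : ∀ p ∈ P, 0 ≤ k * cross (y - x) (p - x) := by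
      intro p hp
      have := hsupp p hp
      have e3 : cross d (p - (x + (1 / 2 : ℝ) • (y - x))) = k * cross (y - x) (p - x) := by
        rw [hk]
        simp only [cross, Pi.add_apply, Pi.sub_apply, Pi.smul_apply, smul_eq_mul]; ring
      rwa [e3] at this
    rcases lt_or_gt_of_ne hkne with hk0 | hk0
    · left
      intro p hp
      nlinarith [h3 p hp]
    · right
      intro p hp
      have := nonneg_of_mul_nonneg_right (h3 p hp) hk0
      linarith
  · intro h q hq
    refine ⟨subset_closure (hsub (openSegment_subset_segment ℝ x y hq)), ?_⟩
    rw [openSegment_eq_image'] at hq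
    obtain ⟨θ, -, rfl⟩ := hq
    have hcr : ∀ (k : ℝ) p, cross (k • (y - x)) (p - (x + θ • (y - x))) =
        k * cross (y - x) (p - x) := by
      intro k p
      simp only [cross, Pi.add_apply, Pi.sub_apply, Pi.smul_apply, smul_eq_mul]; ring
    rcases h with h | h
    · refine notMem_interior_of_side (d := (-1 : ℝ) • (y - x))
        (by simpa [sub_eq_zero, eq_comm] using hne) fun p hp => ?_
      dsimp only
      rw [hcr]
      linarith [h p hp]
    · refine notMem_interior_of_side (d := (1 : ℝ) • (y - x)) (by simpa using hd) fun p hp => ?_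
      dsimp only
      rw [hcr]
      linarith [h p hp]

end Local

/-! ### Counting edges and triangles at a vertex -/

section Count

variable {K : Geometry.SimplicialComplex ℝ (Fin 2 → ℝ)} {P : Set (Fin 2 → ℝ)}

/-- The polygon `P` lies weakly on one side, given by the sign `σ`, of the line through `x`
and `y`. -/
def OnSide (P : Set (Fin 2 → ℝ)) (σ : ℝ) (x y : Fin 2 → ℝ) : Prop :=
  ∀ p ∈ P, σ * cross (y - x) (p - x) ≤ 0

namespace IsUnimodularTriangulation

/-- The finite set of faces of a triangulation. -/
noncomputable def faceFinset (hK : IsUnimodularTriangulation K P) : Finset (Finset (Fin 2 → ℝ)) :=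
  hK.finite_faces.toFinset

lemma mem_faceFinset (hK : IsUnimodularTriangulation K P) {s : Finset (Fin 2 → ℝ)} :
    s ∈ hK.faceFinset ↔ s ∈ K.faces := by
  simp [faceFinset]

/-- The finite set of vertices of a triangulation. -/
noncomputable def vertexFinset (hK : IsUnimodularTriangulation K P) : Finset (Fin 2 → ℝ) :=
  hK.faceFinset.biUnion id

lemma mem_vertexFinset (hK : IsUnimodularTriangulation K P) {x : Fin 2 → ℝ} :
    x ∈ hK.vertexFinset ↔ {x} ∈ K.faces := by
  simp only [vertexFinset, mem_biUnion, mem_faceFinset, id]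
  exact ⟨fun ⟨s, hs, hx⟩ => K.down_closed hs (by simpa using hx) (by simp),
    fun h => ⟨{x}, h, by simp⟩⟩

open Classical in
/-- The neighbours of a vertex of a triangulation. -/
noncomputable def neighbors (hK : IsUnimodularTriangulation K P) (x : Fin 2 → ℝ) : Finset (Fin 2 → ℝ) :=
  {y ∈ hK.vertexFinset | {x, y} ∈ K.faces ∧ y ≠ x}

lemma mem_neighbors (hK : IsUnimodularTriangulation K P) {x y : Fin 2 → ℝ} :
    y ∈ hK.neighbors x ↔ {x, y} ∈ K.faces ∧ y ≠ x := by
  simp only [neighbors, mem_filter, mem_vertexFinset, and_iff_right_iff_imp]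
  exact fun h => K.down_closed h.1 (by simp) (by simp)

lemma mem_of_mem_neighbors (hK : IsUnimodularTriangulation K P) {x y : Fin 2 → ℝ}
    (h : y ∈ hK.neighbors x) : y ∈ P := by
  rw [← hK.space_eq]
  exact K.subset_space (hK.mem_neighbors.1 h).1 (by simp)

-- A supporting line cannot pass through an interior point; at a boundary vertex `exists_side` and
-- `side_unique` give exactly one edge for each sign.
open Classical in
lemma card_filter_onSide (hK : IsUnimodularTriangulation K P) (hP : IsLatticePolygon P) {σ : ℝ}
    (hσ : σ ≠ 0) {x : Fin 2 → ℝ} (hx : {x} ∈ K.faces) :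
    #{y ∈ hK.neighbors x | OnSide P σ x y} = if x ∈ interior P then 0 else 1 := by
  split_ifs with hxi
  · rw [Finset.card_eq_zero, Finset.filter_eq_empty_iff]
    intro y hy h
    have hne := (hK.mem_neighbors.1 hy).2
    refine notMem_interior_of_side (d := (-σ) • (y - x))
      (smul_ne_zero (neg_ne_zero.2 hσ) (sub_ne_zero.2 hne)) (fun p hp => ?_) hxi
    rw [cross_smul_left]
    linarith [h p hp]
  · obtain ⟨y, hy, hne, h⟩ := hK.exists_side hP hσ hx hxi
    rw [Finset.card_eq_one]
    have hyN := hK.mem_neighbors.2 ⟨hy, hne⟩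
    refine ⟨y, Finset.eq_singleton_iff_unique_mem.2 ⟨Finset.mem_filter.2 ⟨hyN, h⟩, ?_⟩⟩
    intro y' hy'
    rw [Finset.mem_filter] at hy'
    have h' := hK.mem_neighbors.1 hy'.1
    exact hP.side_unique hσ hy h'.1 (hK.mem_of_mem_neighbors hyN)
      (hK.mem_of_mem_neighbors hy'.1) hne h'.2 h hy'.2

open Classical in
/-- Edges at a vertex correspond to its neighbours. -/
lemma card_edges (hK : IsUnimodularTriangulation K P) (x : Fin 2 → ℝ)
    (q : Finset (Fin 2 → ℝ) → Prop) :
    #{e ∈ hK.faceFinset | (e.card = 2 ∧ x ∈ e) ∧ q e} = #{y ∈ hK.neighbors x | q {x, y}} := by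
  symm
  refine Finset.card_bij (fun y _ => {x, y}) ?_ ?_ ?_
  · intro y hy
    rw [Finset.mem_filter, mem_neighbors] at hy
    rw [Finset.mem_filter, mem_faceFinset]
    exact ⟨hy.1.1, ⟨Finset.card_pair hy.1.2.symm, by simp⟩, hy.2⟩
  · intro y hy y' hy' h
    rw [Finset.mem_filter, mem_neighbors] at hy
    have : y ∈ ({x, y'} : Finset (Fin 2 → ℝ)) := by rw [← h]; simp
    simp only [Finset.mem_insert, Finset.mem_singleton] at this
    exact this.resolve_left hy.1.2
  · intro e he
    rw [Finset.mem_filter, mem_faceFinset] at he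
    obtain ⟨hef, ⟨hc, hxe⟩, hq⟩ := he
    have hc1 : (e.erase x).card = 1 := by rw [Finset.card_erase_of_mem hxe, hc]
    obtain ⟨y, hy⟩ := Finset.card_eq_one.1 hc1
    have hee : e = {x, y} := by rw [← hy, Finset.insert_erase hxe]
    have hyx : y ≠ x := by
      have : y ∈ e.erase x := by rw [hy]; simp
      exact (Finset.mem_erase.1 this).1
    subst hee
    exact ⟨y, Finset.mem_filter.2 ⟨hK.mem_neighbors.2 ⟨hef, hyx⟩, hq⟩, rfl⟩

lemma mem_facets_of_card (hK : IsUnimodularTriangulation K P) {s : Finset (Fin 2 → ℝ)}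
    (hs : s ∈ K.faces) (hc : s.card = 3) : s ∈ K.facets := by
  obtain ⟨t, ht, hst⟩ := exists_facet hK.finite_faces hs
  rwa [Finset.eq_of_subset_of_card_le hst (by rw [(hK.facet_eq ht).1, hc])]

open Classical in
/-- Triangles at a vertex correspond to the neighbours with a triangle on their left. -/
lemma card_triangles (hK : IsUnimodularTriangulation K P) (hP : IsLatticePolygon P)
    (x : Fin 2 → ℝ) : #{s ∈ hK.faceFinset | s.card = 3 ∧ x ∈ s} =
      #{y ∈ hK.neighbors x | ¬ OnSide P 1 x y} := by
  symm
  have hex : ∀ y ∈ ({y ∈ hK.neighbors x | ¬ OnSide P 1 x y} : Finset _),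
      ∃ z, {x, y, z} ∈ K.faces ∧ 0 < (1 : ℝ) * cross (y - x) (z - x) := by
    intro y hy
    rw [Finset.mem_filter, mem_neighbors, OnSide] at hy
    push Not at hy
    obtain ⟨hy, p, hp, hpos⟩ := hy
    exact hK.exists_triangle_side hP hy.1 hy.2 hp hpos
  choose! z hz hzpos using hex
  have hpos_ne : ∀ {y z : Fin 2 → ℝ}, 0 < (1 : ℝ) * cross (y - x) (z - x) →
      x ≠ y ∧ x ≠ z ∧ y ≠ z := by
    intro y z h
    refine ⟨?_, ?_, ?_⟩ <;> rintro rfl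
    · simp [cross] at h
    · simp [cross] at h
    · simp [cross_self] at h
  refine Finset.card_bij (fun y _ => {x, y, z y}) ?_ ?_ ?_
  · intro y hy
    obtain ⟨h1, h2, h3⟩ := hpos_ne (hzpos y hy)
    rw [Finset.mem_filter, mem_faceFinset]
    exact ⟨hz y hy, Finset.card_eq_three.2 ⟨x, y, z y, h1, h2, h3, rfl⟩, by simp⟩
  · intro y hy y' hy' h
    have hy1 := hzpos y hy
    have hy1' := hzpos y' hy'
    obtain ⟨h1, h2, h3⟩ := hpos_ne hy1
    obtain ⟨h1', h2', h3'⟩ := hpos_ne hy1'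
    have m1 : y ∈ ({x, y', z y'} : Finset (Fin 2 → ℝ)) := by rw [← h]; simp
    have m2 : z y ∈ ({x, y', z y'} : Finset (Fin 2 → ℝ)) := by rw [← h]; simp
    simp only [Finset.mem_insert, Finset.mem_singleton] at m1 m2
    rcases m1 with m1 | m1 | m1
    · exact absurd m1.symm h1
    · exact m1
    · rcases m2 with m2 | m2 | m2
      · exact absurd m2.symm h2
      -- Here the two remaining vertices are exchanged, so the triangle would be positively oriented
      -- in both orders.
      · rw [m2, m1, cross_swap] at hy1
        linarith
      · exact absurd (m1.trans m2.symm) h3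
  · intro s hs
    rw [Finset.mem_filter, mem_faceFinset] at hs
    obtain ⟨hsf, hc, hxs⟩ := hs
    have hfacet := hK.mem_facets_of_card hsf hc
    have main : ∀ a c, s = {x, a, c} → 0 < cross (a - x) (c - x) →
        ∃ (y : _) (hy : y ∈ ({y ∈ hK.neighbors x | ¬ OnSide P 1 x y} : Finset _)),
          ({x, y, z y} : Finset (Fin 2 → ℝ)) = s := by
      rintro a c rfl hac
      rw [← one_mul (cross _ _)] at hac
      obtain ⟨h1, h2, h3⟩ := hpos_ne hac
      have hcP : c ∈ P := by
        rw [← hK.space_eq]; exact K.subset_space hsf (by simp)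
      have ha : a ∈ ({y ∈ hK.neighbors x | ¬ OnSide P 1 x y} : Finset _) := by
        rw [Finset.mem_filter, mem_neighbors]
        refine ⟨⟨K.down_closed hsf (by intro u; simp; tauto) (by simp), h1.symm⟩, fun h => ?_⟩
        exact (h c hcP).not_gt hac
      exact ⟨a, ha, by rw [triangle_side_unique hsf (hz a ha) hac (hzpos a ha)]⟩
    obtain ⟨a, c, ht, -, -, -, hst⟩ := hK.exists_triangle hsf hxs
    have hse : s = {x, a, c} := hfacet.2 ht.1 hst
    have habs := (hK.facet_eq hfacet).2 x a c hse
    -- Of the two other vertices exactly one comes first counterclockwise around `x`; the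
    -- determinant `±1` rules out degeneracy.
    rcases lt_trichotomy (cross (a - x) (c - x)) 0 with h | h | h
    · exact main c a (by rw [hse]; ext; simp; tauto) (by rw [cross_swap]; linarith)
    · rw [h] at habs
      simp at habs
    · exact main a c hse h

lemma mem_interiorEdges_iff (hK : IsUnimodularTriangulation K P) (hP : IsLatticePolygon P)
    {x y : Fin 2 → ℝ} (hy : y ∈ hK.neighbors x) :
    {x, y} ∈ interiorEdges K P ↔ ¬ OnSide P 1 x y ∧ ¬ OnSide P (-1) x y := by
  obtain ⟨hxy, hne⟩ := hK.mem_neighbors.1 hy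
  rw [← not_or, OnSide, OnSide, ← hK.openSegment_subset_frontier_iff hP hxy hne]
  constructor
  · rintro ⟨-, a, b, hab, he, hn⟩
    have ha : a ∈ ({x, y} : Finset (Fin 2 → ℝ)) := by rw [he]; simp
    have hb : b ∈ ({x, y} : Finset (Fin 2 → ℝ)) := by rw [he]; simp
    simp only [Finset.mem_insert, Finset.mem_singleton] at ha hb
    rcases ha with rfl | rfl <;> rcases hb with rfl | rfl
    · exact absurd rfl hab
    · exact hn
    · rwa [openSegment_symm]
    · exact absurd rfl hab
  · exact fun h => ⟨hxy, x, y, hne.symm, rfl, h⟩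

open Classical in
/-- The number of interior edges at a vertex. -/
lemma card_interiorEdges (hK : IsUnimodularTriangulation K P) (hP : IsLatticePolygon P)
    {x : Fin 2 → ℝ} (hx : {x} ∈ K.faces) :
    #{e ∈ hK.faceFinset | (e.card = 2 ∧ x ∈ e) ∧ e ∈ interiorEdges K P} +
      2 * (if x ∈ interior P then 0 else 1) = #(hK.neighbors x) := by
  rw [hK.card_edges, Finset.filter_congr (fun y hy => hK.mem_interiorEdges_iff hP hy)]
  have h1 := hK.card_filter_onSide hP one_ne_zero hx
  have h2 := hK.card_filter_onSide hP (neg_ne_zero.2 one_ne_zero) hx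
  have h3 : #{y ∈ hK.neighbors x | OnSide P 1 x y} + #{y ∈ hK.neighbors x | ¬ OnSide P 1 x y} =
      #(hK.neighbors x) := Finset.card_filter_add_card_filter_not _
  have h4 : #{y ∈ hK.neighbors x | ¬ OnSide P 1 x y ∧ OnSide P (-1) x y} +
      #{y ∈ hK.neighbors x | ¬ OnSide P 1 x y ∧ ¬ OnSide P (-1) x y} =
      #{y ∈ hK.neighbors x | ¬ OnSide P 1 x y} := by
    rw [← Finset.filter_filter, ← Finset.filter_filter]
    exact Finset.card_filter_add_card_filter_not _
  -- `P` is not contained in a line, so no edge is one-sided for both signs and the two kinds of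
  -- boundary edge are disjoint.
  have h5 : #{y ∈ hK.neighbors x | ¬ OnSide P 1 x y ∧ OnSide P (-1) x y} =
      #{y ∈ hK.neighbors x | OnSide P (-1) x y} := by
    congr 1
    refine Finset.filter_congr fun y hy => and_iff_right_of_imp fun h h' => ?_
    obtain ⟨p, hp, hne⟩ := hP.exists_cross_ne_zero x
      (sub_ne_zero.2 (hK.mem_neighbors.1 hy).2)
    have e1 := h p hp
    have e2 := h' p hp
    exact hne (by linarith)
  omega

open Classical in
/-- The number of triangles at a vertex. -/
lemma card_triangles_add (hK : IsUnimodularTriangulation K P) (hP : IsLatticePolygon P)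
    {x : Fin 2 → ℝ} (hx : {x} ∈ K.faces) :
    #{s ∈ hK.faceFinset | s.card = 3 ∧ x ∈ s} + (if x ∈ interior P then 0 else 1) =
      #(hK.neighbors x) := by
  rw [hK.card_triangles hP]
  have h1 := hK.card_filter_onSide hP one_ne_zero hx
  have h3 : #{y ∈ hK.neighbors x | OnSide P 1 x y} + #{y ∈ hK.neighbors x | ¬ OnSide P 1 x y} =
      #(hK.neighbors x) := Finset.card_filter_add_card_filter_not _
  omega

/-! ### Regrouping sums over faces by vertex -/

/-- Double counting of vertices in faces. -/
lemma sum_faces_sum (hK : IsUnimodularTriangulation K P)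
    (c : Finset (Fin 2 → ℝ) → ℝ) : ∑ s ∈ hK.faceFinset, ∑ v ∈ s, c s • v =
      ∑ v ∈ hK.vertexFinset, (∑ s ∈ hK.faceFinset with v ∈ s, c s) • v := by
  simp_rw [Finset.sum_smul]
  refine Finset.sum_comm' fun s v => ?_
  simp only [Finset.mem_filter, vertexFinset, Finset.mem_biUnion, id]
  exact ⟨fun h => ⟨h, s, h⟩, fun h => h.1⟩

open Classical in
lemma sum_choose_card (hK : IsUnimodularTriangulation K P) {v : Fin 2 → ℝ} (hv : {v} ∈ K.faces)
    (n : ℕ) : ∑ s ∈ hK.faceFinset with v ∈ s, (n.choose s.card : ℝ) =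
      n + n.choose 2 * #(hK.neighbors v) +
        n.choose 3 * #{s ∈ hK.faceFinset | s.card = 3 ∧ v ∈ s} := by
  have h1 : #{s ∈ hK.faceFinset | s.card = 1 ∧ v ∈ s} = 1 := by
    rw [Finset.card_eq_one]
    refine ⟨{v}, Finset.eq_singleton_iff_unique_mem.2 ⟨by simp [mem_faceFinset, hv], ?_⟩⟩
    intro s hs
    obtain ⟨-, hc, hvs⟩ := Finset.mem_filter.1 hs
    obtain ⟨a, rfl⟩ := Finset.card_eq_one.1 hc
    rw [Finset.mem_singleton.1 hvs]
  have h2 := hK.card_edges v (fun _ => True)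
  simp only [and_true, Finset.filter_true] at h2
  have h3 : ∀ s ∈ hK.faceFinset, s.card = 1 ∨ s.card = 2 ∨ s.card = 3 := by
    intro s hs
    rw [mem_faceFinset] at hs
    obtain ⟨t, ht, hst⟩ := exists_facet hK.finite_faces hs
    have := Finset.card_le_card hst
    rw [(hK.facet_eq ht).1] at this
    have := (K.nonempty_of_mem_faces hs).card_pos
    omega
  have h4 : ∀ s ∈ hK.faceFinset, (if v ∈ s then (n.choose s.card : ℝ) else 0) =
      (if s.card = 1 ∧ v ∈ s then (n : ℝ) else 0) +
      (if s.card = 2 ∧ v ∈ s then (n.choose 2 : ℝ) else 0) +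
      (if s.card = 3 ∧ v ∈ s then (n.choose 3 : ℝ) else 0) := by
    intro s hs
    by_cases hvs : v ∈ s
    · rcases h3 s hs with h | h | h <;> simp [h, hvs]
    · simp [hvs]
  rw [Finset.sum_filter, Finset.sum_congr rfl h4, Finset.sum_add_distrib,
    Finset.sum_add_distrib, ← Finset.sum_filter, ← Finset.sum_filter, ← Finset.sum_filter,
    Finset.sum_const, Finset.sum_const, Finset.sum_const, h1, h2]
  simp only [nsmul_eq_mul, Nat.cast_one, one_mul]
  ring

lemma finsum_latticePoints (hK : IsUnimodularTriangulation K P) :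
    ∑ᶠ x ∈ latticePoints P, x = ∑ v ∈ hK.vertexFinset, (1 : ℝ) • v := by
  have : latticePoints P = (hK.vertexFinset : Set (Fin 2 → ℝ)) := by
    ext x
    rw [hK.mem_latticePoints_iff, Finset.mem_coe, mem_vertexFinset]
  rw [this, finsum_mem_coe_finset]
  simp

open Classical in
lemma finsum_latticePoints_interior (hK : IsUnimodularTriangulation K P) :
    ∑ᶠ x ∈ latticePoints (interior P), x =
      ∑ v ∈ hK.vertexFinset, (if v ∈ interior P then (1 : ℝ) else 0) • v := by
  have : latticePoints (interior P) =
      ({v ∈ hK.vertexFinset | v ∈ interior P} : Finset (Fin 2 → ℝ)) := by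
    ext x
    rw [Finset.mem_coe, Finset.mem_filter, mem_vertexFinset, ← hK.mem_latticePoints_iff]
    exact ⟨fun h => ⟨⟨interior_subset h.1, h.2⟩, h.1⟩, fun h => ⟨h.2, h.1.2⟩⟩
  rw [this, finsum_mem_coe_finset, Finset.sum_filter]
  simp

open Classical in
lemma finsum_interiorEdges (hK : IsUnimodularTriangulation K P) :
    ∑ᶠ e ∈ interiorEdges K P, ∑ v ∈ e, v =
      ∑ v ∈ hK.vertexFinset,
        (#{e ∈ hK.faceFinset | (e.card = 2 ∧ v ∈ e) ∧ e ∈ interiorEdges K P} : ℝ) • v := by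
  have hcard : ∀ e ∈ interiorEdges K P, e.card = 2 := by
    rintro e ⟨-, y, z, hyz, rfl, -⟩
    exact Finset.card_pair hyz
  have : interiorEdges K P =
      ({e ∈ hK.faceFinset | e ∈ interiorEdges K P} : Finset (Finset (Fin 2 → ℝ))) := by
    ext e
    rw [Finset.mem_coe, Finset.mem_filter, mem_faceFinset]
    exact ⟨fun h => ⟨h.1, h⟩, fun h => h.2⟩
  rw [finsum_mem_congr this (fun _ _ => rfl), finsum_mem_coe_finset, Finset.sum_filter]
  have h1 : ∀ e ∈ hK.faceFinset, (if e ∈ interiorEdges K P then ∑ v ∈ e, v else 0) =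
      ∑ v ∈ e, (if e ∈ interiorEdges K P then (1 : ℝ) else 0) • v := by
    intro e _
    split_ifs <;> simp
  rw [Finset.sum_congr rfl h1, hK.sum_faces_sum]
  refine Finset.sum_congr rfl fun v _ => ?_
  rw [← Finset.sum_filter, Finset.filter_filter, Finset.sum_const, nsmul_eq_mul, mul_one]
  congr 3
  refine Finset.filter_congr fun e _ => ?_
  exact ⟨fun h => ⟨⟨hcard e h.2, h.1⟩, h.2⟩, fun h => ⟨h.1.2, h.2⟩⟩

/-- The discrete moment vectors of the dilates of a triangulated lattice polygon. -/
lemma discreteMomentVector_smul_eq (hK : IsUnimodularTriangulation K P)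
    (hP : IsLatticePolygon P) (n : ℕ) : discreteMomentVector ((n : ℝ) • P) =
      ((n + 2).choose 3 : ℝ) • (∑ᶠ x ∈ latticePoints P, x) +
      ((n + 1).choose 3 : ℝ) • ((∑ᶠ e ∈ interiorEdges K P, ∑ v ∈ e, v) -
        (2 : ℝ) • ∑ᶠ x ∈ latticePoints (interior P), x) +
      (n.choose 3 : ℝ) • ∑ᶠ x ∈ latticePoints (interior P), x := by
  classical
  rcases eq_or_ne n 0 with rfl | hn
  -- The facewise formula was obtained by dividing by `n`; here the dilate contains at most the
  -- origin.
  · have h0 : discreteMomentVector (((0 : ℕ) : ℝ) • P) = 0 := by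
      refine finsum_mem_eq_zero_of_forall_eq_zero ?_
      rintro x ⟨⟨y, -, rfl⟩, -⟩
      simp
    rw [h0]
    simp [Nat.choose]
  rw [hK.discreteMomentVector_smul hn, hK.finsum_latticePoints, hK.finsum_latticePoints_interior,
    hK.finsum_interiorEdges]
  refine (hK.sum_faces_sum (fun s => (n.choose s.card : ℝ))).trans ?_
  simp only [Finset.smul_sum, ← Finset.sum_sub_distrib, ← Finset.sum_add_distrib]
  refine Finset.sum_congr rfl fun v hv => ?_
  rw [mem_vertexFinset] at hv
  rw [hK.sum_choose_card hv]
  have hE := hK.card_interiorEdges hP hv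
  have hT := hK.card_triangles_add hP hv
  have c1 : ((n + 1).choose 3 : ℝ) = n.choose 2 + n.choose 3 := by
    exact_mod_cast Nat.choose_succ_succ' n 2
  have c2 : ((n + 2).choose 3 : ℝ) = n + 2 * n.choose 2 + n.choose 3 := by
    have e1 : (n + 2).choose 3 = (n + 1).choose 2 + (n + 1).choose 3 :=
      Nat.choose_succ_succ' (n + 1) 2
    have e2 : (n + 1).choose 3 = n.choose 2 + n.choose 3 := Nat.choose_succ_succ' n 2
    have e3 : (n + 1).choose 2 = n.choose 1 + n.choose 2 := Nat.choose_succ_succ' n 1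
    rw [Nat.choose_one_right] at e3
    have : (n + 2).choose 3 = n + 2 * n.choose 2 + n.choose 3 := by
      omega
    exact_mod_cast this
  rw [c1, c2, ← hE]
  have hT' : (#{s ∈ hK.faceFinset | s.card = 3 ∧ v ∈ s} : ℝ) =
      #{e ∈ hK.faceFinset | (e.card = 2 ∧ v ∈ e) ∧ e ∈ interiorEdges K P} +
        (if v ∈ interior P then 0 else 1) := by
    split_ifs at hE hT ⊢
    · norm_num; omega
    · have : #{s ∈ hK.faceFinset | s.card = 3 ∧ v ∈ s} =
        #{e ∈ hK.faceFinset | (e.card = 2 ∧ v ∈ e) ∧ e ∈ interiorEdges K P} + 1 := by omega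
      exact_mod_cast this
  rw [hT']
  -- With `β` the boundary indicator and `e` the number of interior edges at `v`, the `C(n,2)` terms
  -- compare as `e + 2β = 2 + e - 2(1 - β)`, and the `C(n,3)` terms as `e + β = 1 + e - 2(1 - β) +
  -- (1 - β)`.
  split_ifs <;> push_cast <;> module

end IsUnimodularTriangulation

end Count

/-! ### Existence and uniqueness of the coefficients -/

/-- The `h¹`-tensor polynomial is determined by the discrete moment vectors of the dilates. -/
lemma isHOneTensorPolynomial_iff {P : Set (Fin 2 → ℝ)} {a b c : Fin 2 → ℝ}
    (hL : ∀ n : ℕ, discreteMomentVector ((n : ℝ) • P) = ((n + 2).choose 3 : ℝ) • a +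
      ((n + 1).choose 3 : ℝ) • b + (n.choose 3 : ℝ) • c)
    (h : PolynomialModule ℝ (Fin 2 → ℝ)) : IsHOneTensorPolynomial P h ↔
      h = PolynomialModule.single ℝ 1 a + PolynomialModule.single ℝ 2 b +
        PolynomialModule.single ℝ 3 c := by
  have hsum : ∀ n : ℕ, ∑ i ∈ Finset.range (2 + 2),
      (((n + 2 + 1 - i).choose (2 + 1) : ℕ) : ℝ) • h.coeff i =
      ((n + 3).choose 3 : ℝ) • h.coeff 0 + ((n + 2).choose 3 : ℝ) • h.coeff 1 +
      ((n + 1).choose 3 : ℝ) • h.coeff 2 + (n.choose 3 : ℝ) • h.coeff 3 := by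
    intro n
    simp [Finset.sum_range_succ]
  simp only [IsHOneTensorPolynomial, hL, hsum]
  constructor
  · rintro ⟨h4, hn⟩
    -- At `n = i` the coefficient `h_i` has factor `C(3,3) = 1` and all later ones have factor 0, so
    -- the coefficients can be solved for in turn.
    have e0 : h.coeff 0 = 0 := by simpa [Nat.choose] using (hn 0).symm
    have e1 : h.coeff 1 = a := by simpa [Nat.choose, e0] using (hn 1).symm
    have e2 : h.coeff 2 = b := by simpa [Nat.choose, e0, e1] using (hn 2).symm
    have e3 : h.coeff 3 = c := by simpa [Nat.choose, e0, e1, e2] using (hn 3).symm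
    apply PolynomialModule.ext
    apply Finsupp.ext
    intro i
    simp only [PolynomialModule.coeff_add, PolynomialModule.coeff_single, Finsupp.add_apply,
      Finsupp.single_apply]
    rcases lt_or_ge 3 i with hi | hi
    · rw [h4 i hi, if_neg (by omega), if_neg (by omega), if_neg (by omega)]
      simp
    · interval_cases i <;> simp [e0, e1, e2, e3]
  · rintro rfl
    simp only [PolynomialModule.coeff_add, PolynomialModule.coeff_single, Finsupp.add_apply,
      Finsupp.single_apply]
    refine ⟨fun i hi => ?_, fun n => ?_⟩
    · rw [if_neg (by omega), if_neg (by omega), if_neg (by omega)]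
      simp
    · simp

end EhrhartTensor

theorem proposition4p1 (P : Set (Fin 2 → ℝ)) (hP : EhrhartTensor.IsLatticePolygon P)
    (K : Geometry.SimplicialComplex ℝ (Fin 2 → ℝ))
    (hK : EhrhartTensor.IsUnimodularTriangulation K P)
    (h : PolynomialModule ℝ (Fin 2 → ℝ)) :
    EhrhartTensor.IsHOneTensorPolynomial P h ↔
      h = PolynomialModule.single ℝ 1 (∑ᶠ x ∈ EhrhartTensor.latticePoints P, x)
        + PolynomialModule.single ℝ 2
            ((∑ᶠ e ∈ EhrhartTensor.interiorEdges K P, ∑ v ∈ e, v)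
              - (2 : ℝ) • ∑ᶠ x ∈ EhrhartTensor.latticePoints (interior P), x)
        + PolynomialModule.single ℝ 3
            (∑ᶠ x ∈ EhrhartTensor.latticePoints (interior P), x) :=
  EhrhartTensor.isHOneTensorPolynomial_iff (hK.discreteMomentVector_smul_eq hP) h
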